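/- A row-finite $\omega\times\omega$ matrix is a matrix $A=(a_{ij})_{i,j\in\mathbb N}$ ($\mathbb N\ni 0$) over $\mathbb C$ each of whose rows $A_i$ has finitely many nonzero entries; it is nonsingular if it has a two-sided inverse among the row-finite matrices, and $A$, $B$ are left associates if $Q\cdot A=B$ for some nonsingular row-finite $Q$. The length $\ell(x)$ of a nonzero row $x$ is the column index of its rightmost nonzero entry. A row-finite matrix $H=(h_{ij})$ is in quasi-Hermite form if (i) the lengths $\ell(H_j)$ of its nonzero rows are strictly increasing in $j$; (ii) $h_{j\,\ell(H_j)}=1$ for every nonzero row $H_j$; (iii) $h_{m\,\ell(H_j)}=0$ for every nonzero row $H_j$ and every $m\neq j$. The infinite Gauss–Jordan algorithm with rightmost pivoting starts with $A$ and performs successively the stages $k=0,1,2,\dots$. In stage $k$ the rows $0,\dots,k-1$ of the current matrix have already been reduced, row $k$ is still $A_k$, and the following row operations are performed. (1) Gaussian elimination: suitable multiples of the nonzero rows $m<k$ are added to row $k$ so as to clear its entries in the columns of the rightmost nonzero entries of these rows. If row $k$ is now zero, the stage ends; otherwise row $k$ is multiplied by a scalar so that its rightmost nonzero entry becomes $1$.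 (2) Jordan elimination: multiples of row $k$ are added to the rows $i<k$ so as to clear their nonzero entries in the column $\ell(\text{row }k)$. (3) Row permutations: if $j_1<\dots<j_r<k$ are the indices of the nonzero rows that are longer than row $k$, then row $k$ moves to position $j_1$, row $j_i$ moves to position $j_{i+1}$ ($1\le i<r$) and row $j_r$ moves to position $k$, by interchanges of rows, while the zero rows stay in place. Theorem. Let $A$ be any row-finite $\omega\times\omega$ matrix over $\mathbb C$. All row operations performed by the algorithm are elementary. When the whole sequence of these operations is carried out on $A$, every row is eventually constant; let $H$ be the matrix of the final rows. Likewise, when the same sequence of operations is carried out on the identity matrix, every row is eventually constant; let $Q$ be the matrix of the final rows (the composite of the sequence of operations). Then $H$ and $Q$ are row-finite, $Q$ is nonsingular, $Q\cdot A=H$ (so that $A$ and $H$ are left associates), and $H$ is in quasi-Hermite form. In particular, every row-finite matrix $A$ has a quasi-Hermite form, that is, a left associate in quasi-Hermite form. -/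

import Mathlib

noncomputable section

/-- Row-finite `ω × ω` matrices over `ℂ`: sequences of finitely supported rows. The entry in
row `i` and column `j` of `A` is `A i j`. -/
abbrev RFM : Type := ℕ → (ℕ →₀ ℂ)

namespace RFM

/-- The identity `ω × ω` matrix. -/
def one : RFM := fun i => Finsupp.single i 1

/-- Matrix multiplication: row `i` of `A · B` is `∑ k, A i k • B k`, a finite sum. -/
def mul (A B : RFM) : RFM := fun i => (A i).sum fun k c => c • B k

/-- Sanity check: the entries of a product are given by the usual formula. -/
theorem mul_entry (A B : RFM) (i j : ℕ) :
    mul A B i j = ∑ k ∈ (A i).support, A i k * B k j := by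
  simp [mul, Finsupp.sum, Finsupp.finsetSum_apply]

/-- `Q` is nonsingular: it has a two-sided inverse among the row-finite matrices. -/
def Nonsingular (Q : RFM) : Prop := ∃ P : RFM, mul Q P = one ∧ mul P Q = one

/-- `A` and `B` are left associates: `Q · A = B` for some nonsingular row-finite `Q`. -/
def LeftAssociates (A B : RFM) : Prop := ∃ Q : RFM, Nonsingular Q ∧ mul Q A = B

/-- The length of a nonzero row: the column index of its rightmost nonzero entry. (The value on
the zero row is `0`; below, the length is used for nonzero rows only.) -/
def rowLength (x : ℕ →₀ ℂ) : ℕ := x.support.sup id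

/-- Quasi-Hermite form. -/
structure IsQHF (H : RFM) : Prop where
  /-- the lengths of the nonzero rows are strictly increasing -/
  length_lt : ∀ i j, i < j → H i ≠ 0 → H j ≠ 0 → rowLength (H i) < rowLength (H j)
  /-- the rightmost nonzero entry of every nonzero row is `1` -/
  pivot_eq_one : ∀ j, H j ≠ 0 → H j (rowLength (H j)) = 1
  /-- all other entries in the column of such a rightmost `1` vanish -/
  pivot_col : ∀ j m, H j ≠ 0 → j ≠ m → H m (rowLength (H j)) = 0

/-- Row operations: interchange rows `i` and `j`; multiply row `i` by `c`;
add `c` times row `j` to row `i`. -/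
inductive RowOp : Type
  | swap (i j : ℕ)
  | scale (i : ℕ) (c : ℂ)
  | addMul (i j : ℕ) (c : ℂ)

/-- The conditions under which a row operation is an elementary one. -/
def RowOp.IsElementary : RowOp → Prop
  | .swap i j => i ≠ j
  | .scale _ c => c ≠ 0
  | .addMul i j _ => i ≠ j

/-- The effect of a row operation on a matrix. -/
def RowOp.apply : RowOp → RFM → RFM
  | .swap i j, M => fun r => M (Equiv.swap i j r)
  | .scale i c, M => Function.update M i (c • M i)
  | .addMul i j c, M => Function.update M i (M i + c • M j)

/-- Apply a finite sequence of row operations, the first one in the list first. -/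
def run (l : List RowOp) (M : RFM) : RFM := l.foldl (fun N op => op.apply N) M

/-- Gaussian elimination on row `k`: the rightmost nonzero entries of the nonzero rows `m < k`
are the pivots that clear the nonzero entries of row `k` in their columns. (The rows `m < k` are
already reduced, so clearing one pivot column does not change the entry of row `k` in another
one.) -/
def gaussOps (M : RFM) (k : ℕ) : List RowOp :=
  open Classical in
  ((List.range k).filter fun m => M m ≠ 0 ∧ M k (rowLength (M m)) ≠ 0).map
    fun m => .addMul k m (-(M k (rowLength (M m))))

/-- Normalization: unless row `k` is zero, its rightmost nonzero entry is made `1`. -/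
def normOps (M : RFM) (k : ℕ) : List RowOp :=
  open Classical in
  if M k = 0 then [] else [.scale k (M k (rowLength (M k)))⁻¹]

/-- Jordan elimination: unless row `k` is zero, it is used as pivot row to clear the nonzero
entries of the rows `i < k` above its rightmost `1`. -/
def jordanOps (M : RFM) (k : ℕ) : List RowOp :=
  open Classical in
  if M k = 0 then [] else
    ((List.range k).filter fun i => M i (rowLength (M k)) ≠ 0).map
      fun i => .addMul i k (-(M i (rowLength (M k))))

/-- Row permutations: let `j₁ < ⋯ < jᵣ < k` be the indices of the nonzero rows longer than the
nonzero row `k`. The interchanges `(k j₁), …, (k jᵣ)`, in this order, move row `k` to position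
`j₁`, row `jᵢ` to position `jᵢ₊₁` and row `jᵣ` to position `k`; zero rows stay in place. -/
def permOps (M : RFM) (k : ℕ) : List RowOp :=
  open Classical in
  if M k = 0 then [] else
    ((List.range k).filter fun j => M j ≠ 0 ∧ rowLength (M k) < rowLength (M j)).map
      fun j => .swap k j

/-- The operations of stage `k`, carried out on a matrix `M` whose rows `0, …, k - 1` have
already been reduced and whose row `k` is the newly inserted row. -/
def stageOps (M : RFM) (k : ℕ) : List RowOp :=
  let g := gaussOps M k
  let M₁ := run g M
  let n := normOps M₁ k
  let M₂ := run n M₁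
  let e := jordanOps M₂ k
  let M₃ := run e M₂
  g ++ n ++ e ++ permOps M₃ k

/-- All the row operations of the stages `0, …, k - 1` of the infinite Gauss–Jordan algorithm
with rightmost pivoting on input `A`. The first `k` rows of `run (opsBefore A k) A` are the
finite matrix in quasi-Hermite form obtained from the first `k` rows of `A`; the other rows are
still those of `A`. -/
def opsBefore (A : RFM) : ℕ → List RowOp
  | 0 => []
  | k + 1 => opsBefore A k ++ stageOps (run (opsBefore A k) A) k

/-- `l` is a finite initial segment of the whole sequence of row operations that the algorithm
performs on input `A` (it may end in the middle of a stage). -/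
def IsInitialSegment (A : RFM) (l : List RowOp) : Prop := ∃ k, l <+: opsBefore A k

/-- When the whole sequence of row operations determined by the algorithm on input `A` is carried
out on the matrix `M`, every row is eventually constant, and `L` is the resulting matrix. -/
def ResultsIn (A M L : RFM) : Prop :=
  ∀ n, ∃ N, ∀ l, IsInitialSegment A l → opsBefore A N <+: l → run l M n = L n

end RFM

end

noncomputable section

namespace RFM

/-! ### Row lengths -/

/-! Convergence. Gaussian elimination clears the new row in every old pivot column, and Jordan
elimination and permutations keep old pivot columns. So the pivot rows found in different stages
have different lengths (`pivotRow_length_injOn`), and for each `p` only finitely many stages produce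
a pivot in a column up to `p`. On the other hand, a row position `n` never gets longer after stage
`n` (`rowLength_stageMatrix_le`). Once all new pivots lie beyond its length, Jordan elimination
finds nothing to clear there and permutations pass it by (`exists_finalFrom`).

Algebra of the limit. The operations are chosen from `A` but commute with right multiplication, so
`Q · A = H` can be read off row by row at a finite stage. Quasi-Hermite form concerns two rows at a
time and is also inherited from a finite stage.

Nonsingularity of `Q`. A linear relation involves finitely many rows, hence already holds at a
finite, invertible stage; so the rows of `Q` are independent. That they span is not automatic for a
limit of invertible matrices. The invariant is `boundedSpan`: the span of the rows whose images
under `A` have length at most `p` only grows with the stage (`boundedSpan_le_run_stageOps`). Each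
unit vector enters such a span, and once new pivots lie beyond `p` all generating rows are final. -/

theorem rowLength_le_iff {x : ℕ →₀ ℂ} {p : ℕ} : rowLength x ≤ p ↔ ∀ c, x c ≠ 0 → c ≤ p := by
  simp [rowLength, Finset.sup_le_iff]

theorem le_rowLength {x : ℕ →₀ ℂ} {c : ℕ} (h : x c ≠ 0) : c ≤ rowLength x :=
  rowLength_le_iff.1 le_rfl c h

theorem apply_rowLength_ne_zero {x : ℕ →₀ ℂ} (h : x ≠ 0) : x (rowLength x) ≠ 0 := by
  have hs : x.support.Nonempty := Finsupp.support_nonempty_iff.2 h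
  obtain ⟨c, hc, he⟩ := Finset.exists_mem_eq_sup _ hs id
  have : rowLength x = c := he
  rw [this]
  exact Finsupp.mem_support_iff.1 hc

/-- The bound on `y` is needed only for `d ≠ 0`. This suits Jordan elimination: the pivot row is
really added only to rows with an entry in the pivot column, and these are at least as long as it.
-/
theorem rowLength_add_smul_le {x y : ℕ →₀ ℂ} {p : ℕ} (d : ℂ) (hx : rowLength x ≤ p)
    (hy : d ≠ 0 → rowLength y ≤ p) : rowLength (x + d • y) ≤ p := by
  rw [rowLength_le_iff] at *
  intro c hc
  by_contra hcp
  have h1 : x c = 0 := by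
    by_contra h
    exact hcp (hx c h)
  apply hc
  by_cases hd : d = 0
  · simp [hd, h1]
  · have h2 : y c = 0 := by
      by_contra h
      exact hcp (hy hd c h)
    simp [h1, h2]

/-! ### Matrix multiplication and linear maps -/

theorem mul_row (A B : RFM) (i : ℕ) : mul A B i = Finsupp.linearCombination ℂ B (A i) := rfl

theorem one_mul (A : RFM) : mul one A = A := by
  funext i
  simp [mul_row, one]

theorem linearCombination_mul (A B : RFM) (x : ℕ →₀ ℂ) :
    Finsupp.linearCombination ℂ (mul A B) x =
      Finsupp.linearCombination ℂ B (Finsupp.linearCombination ℂ A x) := by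
  have h : Finsupp.linearCombination ℂ (mul A B) =
      (Finsupp.linearCombination ℂ B).comp (Finsupp.linearCombination ℂ A) := by
    ext i : 2
    simp [mul_row]
  rw [h, LinearMap.comp_apply]

theorem linearCombination_one (x : ℕ →₀ ℂ) : Finsupp.linearCombination ℂ one x = x := by
  have h : Finsupp.linearCombination ℂ one = LinearMap.id := by
    ext i : 2
    simp [one]
  rw [h, LinearMap.id_apply]

/-- The map is `x ↦ x · Q` on finitely supported row vectors; the images of the unit vectors under
its inverse are the rows of the inverse matrix, so row-finiteness is automatic. -/
theorem nonsingular_of_bijective {Q : RFM}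
    (h : Function.Bijective (Finsupp.linearCombination ℂ Q)) : Nonsingular Q := by
  let e := LinearEquiv.ofBijective _ h
  have he : ∀ x, e x = Finsupp.linearCombination ℂ Q x := fun x => rfl
  have hP : ∀ x, Finsupp.linearCombination ℂ (fun i => e.symm (one i)) x = e.symm x := by
    intro x
    have : Finsupp.linearCombination ℂ (fun i => e.symm (one i)) = e.symm.toLinearMap := by
      ext i : 2
      simp [one]
    rw [this]
    rfl
  refine ⟨fun i => e.symm (one i), ?_, ?_⟩
  · funext i
    rw [mul_row, hP, LinearEquiv.symm_apply_eq, he]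
    simp [one]
  · funext i
    rw [mul_row, ← he, LinearEquiv.apply_symm_apply]

/-! ### Sequences of row operations -/

@[simp] theorem run_nil (M : RFM) : run [] M = M := rfl

theorem run_cons (op : RowOp) (l : List RowOp) (M : RFM) :
    run (op :: l) M = run l (op.apply M) := rfl

theorem run_append (l l' : List RowOp) (M : RFM) : run (l ++ l') M = run l' (run l M) := by
  simp [run]

theorem apply_mul (op : RowOp) (Q A : RFM) : op.apply (mul Q A) = mul (op.apply Q) A := by
  funext r
  cases op with
  | swap i j => rfl
  | scale i c =>
    by_cases h : r = i
    · subst h; simp [RowOp.apply, mul_row]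
    · simp [RowOp.apply, mul_row, h]
  | addMul i j c =>
    by_cases h : r = i
    · subst h; simp [RowOp.apply, mul_row]
    · simp [RowOp.apply, mul_row, h]

theorem run_mul (l : List RowOp) (Q A : RFM) : run l (mul Q A) = mul (run l Q) A := by
  induction l generalizing Q with
  | nil => rfl
  | cons op l ih => rw [run_cons, run_cons, apply_mul, ih]

/-- The inverse row operation. -/
def RowOp.inv : RowOp → RowOp
  | .swap i j => .swap i j
  | .scale i c => .scale i c⁻¹
  | .addMul i j c => .addMul i j (-c)

theorem RowOp.apply_inv {op : RowOp} (h : op.IsElementary) (M : RFM) :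
    op.apply (op.inv.apply M) = M := by
  funext r
  cases op with
  | swap i j => simp [RowOp.apply, RowOp.inv]
  | scale i c =>
    have hc : c ≠ 0 := h
    by_cases hr : r = i
    · subst hr; simp [RowOp.apply, RowOp.inv, smul_smul, hc]
    · simp [RowOp.apply, RowOp.inv, hr]
  | addMul i j c =>
    have hij : j ≠ i := Ne.symm h
    by_cases hr : r = i
    · subst hr; simp [RowOp.apply, RowOp.inv, hij]
    · simp [RowOp.apply, RowOp.inv, hr]

theorem exists_run_eq {l : List RowOp} (h : ∀ op ∈ l, op.IsElementary) (M : RFM) :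
    ∃ N, run l N = M := by
  induction l with
  | nil => exact ⟨M, rfl⟩
  | cons op l ih =>
    obtain ⟨N, hN⟩ := ih fun o ho => h o (by simp [ho])
    exact ⟨op.inv.apply N, by rw [run_cons, RowOp.apply_inv (h op (by simp)), hN]⟩

theorem injective_run_one {l : List RowOp} (h : ∀ op ∈ l, op.IsElementary) :
    Function.Injective (Finsupp.linearCombination ℂ (run l one)) := by
  obtain ⟨N, hN⟩ := exists_run_eq h one
  -- Now `N` is a right inverse of `run l one`, and multiplying row vectors by it undoes the map.
  rw [← one_mul N, run_mul] at hN
  intro x y hxy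
  have := congrArg (Finsupp.linearCombination ℂ N) hxy
  rwa [← linearCombination_mul, ← linearCombination_mul, hN, linearCombination_one,
    linearCombination_one] at this

/-- The operation may change row `n`. -/
def RowOp.Touches (n : ℕ) : RowOp → Prop
  | .swap i j => n = i ∨ n = j
  | .scale i _ => n = i
  | .addMul i _ _ => n = i

theorem run_of_not_touches {l : List RowOp} {n : ℕ} (h : ∀ op ∈ l, ¬ op.Touches n) (M : RFM) :
    run l M n = M n := by
  induction l generalizing M with
  | nil => rfl
  | cons op l ih =>
    rw [run_cons, ih fun o ho => h o (by simp [ho])]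
    have := h op (by simp)
    cases op with
    | swap i j =>
      simp only [RowOp.Touches, not_or] at this
      simp [RowOp.apply, Equiv.swap_apply_of_ne_of_ne this.1 this.2]
    | scale i c => simp [RowOp.apply, show n ≠ i from this]
    | addMul i j c => simp [RowOp.apply, show n ≠ i from this]

/-- The operation involves rows with index below `k` only. -/
def RowOp.Below (k : ℕ) : RowOp → Prop
  | .swap i j => i < k ∧ j < k
  | .scale i _ => i < k
  | .addMul i j _ => i < k ∧ j < k

theorem RowOp.Below.mono {k k' : ℕ} (hk : k ≤ k') {op : RowOp} (h : op.Below k) :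
    op.Below k' := by
  cases op <;> simp only [RowOp.Below] at * <;> omega

/-- Undoing an elementary operation writes each old row in terms of new ones, and no index `k` or
above enters. -/
theorem mem_span_apply {k : ℕ} {op : RowOp} (he : op.IsElementary) (hb : op.Below k) (M : RFM)
    {r : ℕ} (hr : r < k) : M r ∈ Submodule.span ℂ (op.apply M '' Set.Iio k) := by
  have hmem : ∀ s < k, op.apply M s ∈ Submodule.span ℂ (op.apply M '' Set.Iio k) :=
    fun s hs => Submodule.subset_span ⟨s, hs, rfl⟩
  cases op with
  | swap i j =>
    have h : Equiv.swap i j r < k := by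
      obtain ⟨hi, hj⟩ := hb
      rw [Equiv.swap_apply_def]
      split_ifs <;> assumption
    simpa [RowOp.apply] using hmem _ h
  | scale i c =>
    have hc : c ≠ 0 := he
    by_cases h : r = i
    · subst h
      have := Submodule.smul_mem _ c⁻¹ (hmem r hr)
      simpa [RowOp.apply, smul_smul, hc] using this
    · simpa [RowOp.apply, h] using hmem r hr
  | addMul i j c =>
    have hij : j ≠ i := Ne.symm he
    by_cases h : r = i
    · subst h
      have := Submodule.sub_mem _ (hmem r hr) (Submodule.smul_mem _ c (hmem j hb.2))
      simpa [RowOp.apply, hij] using this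
    · simpa [RowOp.apply, h] using hmem r hr

theorem mem_span_run {k : ℕ} {l : List RowOp} (he : ∀ op ∈ l, op.IsElementary)
    (hb : ∀ op ∈ l, op.Below k) (M : RFM) {r : ℕ} (hr : r < k) :
    M r ∈ Submodule.span ℂ (run l M '' Set.Iio k) := by
  induction l generalizing M r with
  | nil => exact Submodule.subset_span ⟨r, hr, rfl⟩
  | cons op l ih =>
    have h1 := mem_span_apply (he op (by simp)) (hb op (by simp)) M hr
    refine Submodule.span_le.2 ?_ h1
    rintro _ ⟨s, hs, rfl⟩
    exact ih (fun o ho => he o (by simp [ho])) (fun o ho => hb o (by simp [ho])) _ hs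

/-! ### The effect of the four parts of a stage -/

theorem run_map_addMul_target (k : ℕ) (c : ℕ → ℂ) (L : List ℕ) (hk : k ∉ L) (M : RFM) :
    run (L.map fun m => .addMul k m (c m)) M k = M k + (L.map fun m => c m • M m).sum := by
  induction L generalizing M with
  | nil => simp
  | cons m L ih =>
    rw [List.mem_cons, not_or] at hk
    rw [List.map_cons, run_cons, ih hk.2, List.map_cons, List.sum_cons, ← add_assoc]
    congr 1
    · simp [RowOp.apply]
    · congr 1
      refine List.map_congr_left fun a ha => ?_
      have : a ≠ k := fun h => hk.2 (h ▸ ha)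
      simp [RowOp.apply, this]

theorem run_map_addMul_source (k : ℕ) (c : ℕ → ℂ) (L : List ℕ) (hk : k ∉ L) (hL : L.Nodup)
    (M : RFM) (i : ℕ) :
    run (L.map fun m => .addMul m k (c m)) M i = M i + (if i ∈ L then c i else 0) • M k := by
  induction L generalizing M with
  | nil => simp
  | cons m L ih =>
    rw [List.mem_cons, not_or] at hk
    rw [List.nodup_cons] at hL
    rw [List.map_cons, run_cons, ih hk.2 hL.2]
    by_cases h : i = m
    · subst h
      simp [RowOp.apply, hk.1, hL.1]
    · simp [RowOp.apply, h, hk.1]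

/-- One `σ` serves all `N`: the interchanges chosen from the reduced matrix are also carried out on
the transforming matrix. -/
theorem exists_perm_run_map_swap (k : ℕ) (L : List ℕ) :
    ∃ σ : Equiv.Perm ℕ, (∀ N, run (L.map fun j => .swap k j) N = fun r => N (σ r)) ∧
      ∀ r, r ≠ k → r ∉ L → σ r = r := by
  induction L with
  | nil => exact ⟨1, fun N => rfl, fun r _ _ => rfl⟩
  | cons j L ih =>
    obtain ⟨σ, h1, h2⟩ := ih
    refine ⟨σ.trans (Equiv.swap k j), fun N => ?_, fun r hk hr => ?_⟩
    · rw [List.map_cons, run_cons, h1]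
      rfl
    · rw [List.mem_cons, not_or] at hr
      rw [Equiv.trans_apply, h2 r hk hr.2, Equiv.swap_apply_of_ne_of_ne hk hr.1]

/-- The cyclic interchanges of row `k` with rows of increasing length sort these rows, and no row
above row `k` becomes longer. -/
theorem run_map_swap_sorted (k : ℕ) (L : List ℕ) (hL : L.Pairwise (· < ·)) (hk : ∀ j ∈ L, j < k)
    (N : RFM) (hs : L.Pairwise fun i j => rowLength (N i) < rowLength (N j))
    (hN : ∀ j ∈ L, rowLength (N k) < rowLength (N j)) :
    (∀ i, i = k ∨ i ∈ L →
      rowLength (N k) ≤ rowLength (run (L.map fun j => .swap k j) N i)) ∧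
    (∀ i j, i ∈ L → (j = k ∨ j ∈ L) → i < j →
      rowLength (run (L.map fun j => .swap k j) N i) <
        rowLength (run (L.map fun j => .swap k j) N j)) ∧
    ∀ i ∈ L, rowLength (run (L.map fun j => .swap k j) N i) < rowLength (N i) := by
  induction L generalizing N with
  | nil => simp
  | cons m L ih =>
    rw [List.pairwise_cons] at hL hs
    have hmk : m < k := hk m (by simp)
    have hNk : (RowOp.swap k m).apply N k = N m := by simp [RowOp.apply]
    have hNm : (RowOp.swap k m).apply N m = N k := by simp [RowOp.apply]
    have hNj : ∀ j ∈ L, (RowOp.swap k m).apply N j = N j := fun j hj => by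
      have h1 := hL.1 j hj
      have h2 := hk j (by simp [hj])
      simp [RowOp.apply, Equiv.swap_apply_of_ne_of_ne (show j ≠ k by omega) (show j ≠ m by omega)]
    -- After the first interchange, row `k` holds the old row `m`, which is shorter than all rows
    -- still to be exchanged, so the induction hypothesis applies to it.
    obtain ⟨h1, h2, h3⟩ := ih hL.2 (fun j hj => hk j (by simp [hj])) ((RowOp.swap k m).apply N)
      (hs.2.imp_of_mem fun ha hb h => by rwa [hNj _ ha, hNj _ hb])
      (fun j hj => by rw [hNk, hNj j hj]; exact hs.1 j hj)
    have hm : run (L.map fun j => .swap k j) ((RowOp.swap k m).apply N) m = N k := by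
      rw [run_of_not_touches, hNm]
      intro op hop
      obtain ⟨j, hj, rfl⟩ := List.mem_map.1 hop
      have := hL.1 j hj
      simp only [RowOp.Touches]
      omega
    have hlt := hN m (by simp)
    rw [List.map_cons, run_cons]
    rw [hNk] at h1
    refine ⟨fun i hi => ?_, fun i j hi hj hij => ?_, fun i hi => ?_⟩
    · by_cases him : i = m
      · rw [him, hm]
      · exact hlt.le.trans (h1 i (by simpa [him] using hi))
    · have hjm : j ≠ m := by
        rintro rfl
        rcases List.mem_cons.1 hi with rfl | hi
        · exact absurd hij (lt_irrefl _)
        · exact absurd (hL.1 i hi) (by omega)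
      have hj' : j = k ∨ j ∈ L := by simpa [hjm] using hj
      rcases List.mem_cons.1 hi with rfl | hi
      · rw [hm]
        exact hlt.trans_le (h1 j hj')
      · exact h2 i j hi hj' hij
    · rcases List.mem_cons.1 hi with rfl | hi
      · rw [hm]
        exact hlt
      · exact (h3 i hi).trans_eq (by rw [hNj i hi])

/-- The first `k` rows have rightmost nonzero entries `1`, alone in their columns. -/
def Reduced (k : ℕ) (M : RFM) : Prop :=
  ∀ i < k, M i ≠ 0 → M i (rowLength (M i)) = 1 ∧ ∀ j < k, j ≠ i → M j (rowLength (M i)) = 0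

/-- The lengths of the nonzero rows among the first `k` ones are strictly increasing. -/
def Sorted (k : ℕ) (M : RFM) : Prop :=
  ∀ i j, i < j → j < k → M i ≠ 0 → M j ≠ 0 → rowLength (M i) < rowLength (M j)

/-- The matrix after Gaussian elimination on row `k` and normalization. -/
def normalized (M : RFM) (k : ℕ) : RFM :=
  run (normOps (run (gaussOps M k) M) k) (run (gaussOps M k) M)

/-- The matrix after Jordan elimination with row `k`. -/
def eliminated (M : RFM) (k : ℕ) : RFM :=
  run (jordanOps (normalized M k) k) (normalized M k)

theorem stageOps_eq (M : RFM) (k : ℕ) :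
    stageOps M k = gaussOps M k ++ normOps (run (gaussOps M k) M) k ++
      jordanOps (normalized M k) k ++ permOps (eliminated M k) k := rfl

theorem gaussOps_target {M : RFM} {k : ℕ} {op : RowOp} (h : op ∈ gaussOps M k) :
    op.IsElementary ∧ op.Below (k + 1) ∧ ∀ n, op.Touches n → n = k := by
  simp only [gaussOps, List.mem_map, List.mem_filter, List.mem_range] at h
  obtain ⟨m, ⟨hm, -⟩, rfl⟩ := h
  simp only [RowOp.IsElementary, RowOp.Below, RowOp.Touches]
  refine ⟨by omega, by omega, fun n h => h⟩

theorem normOps_target {M : RFM} {k : ℕ} {op : RowOp} (h : op ∈ normOps M k) :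
    op.IsElementary ∧ op.Below (k + 1) ∧ ∀ n, op.Touches n → n = k := by
  unfold normOps at h
  split_ifs at h with h0
  · simp at h
  · rw [List.mem_singleton] at h
    subst h
    simp only [RowOp.IsElementary, RowOp.Below, RowOp.Touches]
    exact ⟨inv_ne_zero (apply_rowLength_ne_zero h0), by omega, fun n h => h⟩

theorem jordanOps_target {M : RFM} {k : ℕ} {op : RowOp} (h : op ∈ jordanOps M k) :
    op.IsElementary ∧ op.Below (k + 1) ∧
      ∀ n, op.Touches n → n < k ∧ M k ≠ 0 ∧ M n (rowLength (M k)) ≠ 0 := by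
  unfold jordanOps at h
  split_ifs at h with h0
  · simp at h
  · simp only [List.mem_map, List.mem_filter, List.mem_range, decide_eq_true_eq] at h
    obtain ⟨m, ⟨hm, h1⟩, rfl⟩ := h
    simp only [RowOp.IsElementary, RowOp.Below, RowOp.Touches]
    refine ⟨by omega, by omega, ?_⟩
    rintro n rfl
    exact ⟨hm, h0, h1⟩

theorem permOps_target {M : RFM} {k : ℕ} {op : RowOp} (h : op ∈ permOps M k) :
    op.IsElementary ∧ op.Below (k + 1) ∧
      ∀ n, op.Touches n → n = k ∨ n < k ∧ M k ≠ 0 ∧ rowLength (M k) < rowLength (M n) := by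
  unfold permOps at h
  split_ifs at h with h0
  · simp at h
  · simp only [List.mem_map, List.mem_filter, List.mem_range, decide_eq_true_eq] at h
    obtain ⟨m, ⟨hm, h1⟩, rfl⟩ := h
    simp only [RowOp.IsElementary, RowOp.Below, RowOp.Touches]
    refine ⟨by omega, by omega, ?_⟩
    rintro n (rfl | rfl)
    · exact Or.inl rfl
    · exact Or.inr ⟨hm, h0, h1.2⟩

theorem stageOps_elementary_below {M : RFM} {k : ℕ} {op : RowOp} (h : op ∈ stageOps M k) :
    op.IsElementary ∧ op.Below (k + 1) := by
  simp only [stageOps_eq, List.mem_append] at h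
  rcases h with ((h | h) | h) | h
  · exact ⟨(gaussOps_target h).1, (gaussOps_target h).2.1⟩
  · exact ⟨(normOps_target h).1, (normOps_target h).2.1⟩
  · exact ⟨(jordanOps_target h).1, (jordanOps_target h).2.1⟩
  · exact ⟨(permOps_target h).1, (permOps_target h).2.1⟩

/-- Gaussian elimination and normalization change row `k` only. -/
theorem run_gaussOps_normOps_of_ne (M M' N : RFM) {k i : ℕ} (h : i ≠ k) :
    run (gaussOps M k ++ normOps M' k) N i = N i := by
  refine run_of_not_touches (fun op hop ht => ?_) N
  rcases List.mem_append.1 hop with hop | hop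
  · exact h ((gaussOps_target hop).2.2 i ht)
  · exact h ((normOps_target hop).2.2 i ht)

theorem normalized_of_ne (M : RFM) {k i : ℕ} (h : i ≠ k) : normalized M k i = M i := by
  rw [normalized, ← run_append, run_gaussOps_normOps_of_ne _ _ _ h]

/-- Jordan elimination, carried out on any matrix. -/
theorem run_jordanOps (M N : RFM) (k i : ℕ) :
    ∃ d : ℂ, run (jordanOps M k) N i = N i + d • N k ∧
      (M k = 0 → d = 0) ∧ (i = k → d = 0) ∧
      (M k ≠ 0 → i < k → d = -(M i (rowLength (M k)))) := by
  classical
  by_cases h0 : M k = 0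
  · exact ⟨0, by simp [jordanOps, h0], by simp [h0]⟩
  · refine ⟨if i ∈ (List.range k).filter fun i => M i (rowLength (M k)) ≠ 0 then
      -(M i (rowLength (M k))) else 0, ?_, ?_⟩
    · simp only [jordanOps, h0, if_false]
      rw [run_map_addMul_source k (fun i => -(M i (rowLength (M k)))) _ (by simp)
        (List.nodup_range.filter _)]
    · refine ⟨fun h => absurd h h0, ?_, fun _ hi => ?_⟩
      · rintro rfl
        simp
      · by_cases h1 : M i (rowLength (M k)) = 0 <;> simp [h1, hi]

/-- In the pivot column of row `m` the other rows above row `k` vanish, so only the multiple of row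
`m` affects that entry. -/
theorem gaussOps_clears {M : RFM} {k : ℕ} (hM : Reduced k M) {m : ℕ} (hm : m < k)
    (hm0 : M m ≠ 0) : run (gaussOps M k) M k (rowLength (M m)) = 0 := by
  classical
  unfold gaussOps
  rw [run_map_addMul_target k (fun m => -(M k (rowLength (M m)))) _ (by simp),
    ← List.sum_toFinset _ (List.nodup_range.filter _), Finsupp.add_apply,
    Finsupp.finsetSum_apply]
  by_cases h : M k (rowLength (M m)) = 0
  · rw [h, zero_add]
    refine Finset.sum_eq_zero fun a ha => ?_
    simp only [List.toFinset_filter, Finset.mem_filter, List.mem_toFinset, List.mem_range,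
      decide_eq_true_eq] at ha
    have ham : a ≠ m := by
      rintro rfl
      exact ha.2.2 h
    simp [(hM m hm hm0).2 a ha.1 ham]
  · rw [Finset.sum_eq_single m]
    · simp [(hM m hm hm0).1]
    · intro a ha ham
      simp only [List.toFinset_filter, Finset.mem_filter, List.mem_toFinset, List.mem_range] at ha
      simp [(hM m hm hm0).2 a ha.1 ham]
    · intro hn
      exact absurd (by simp [hm, hm0, h]) hn

theorem normalized_clears {M : RFM} {k : ℕ} (hM : Reduced k M) {m : ℕ} (hm : m < k)
    (hm0 : M m ≠ 0) : normalized M k k (rowLength (M m)) = 0 := by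
  have h := gaussOps_clears hM hm hm0
  unfold normalized normOps
  split_ifs
  · exact h
  · simp [run_cons, RowOp.apply, h]

theorem normalized_pivot {M : RFM} {k : ℕ} (h : normalized M k k ≠ 0) :
    normalized M k k (rowLength (normalized M k k)) = 1 := by
  unfold normalized normOps at *
  split_ifs at * with h0
  · exact absurd h0 h
  · have hp := apply_rowLength_ne_zero h0
    have hl : ∀ (c : ℂ) (x : ℕ →₀ ℂ), c ≠ 0 → rowLength (c • x) = rowLength x := by
      intro c x hc
      rw [rowLength, rowLength, Finsupp.support_smul_eq hc]
    simp [run_cons, RowOp.apply, hl _ _ (inv_ne_zero hp), hp]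

theorem eliminated_self (M : RFM) (k : ℕ) : eliminated M k k = normalized M k k := by
  obtain ⟨d, h, -, h2, -⟩ := run_jordanOps (normalized M k) (normalized M k) k k
  rw [eliminated, h, h2 rfl]
  simp

theorem eliminated_of_lt {M : RFM} {k i : ℕ} (h0 : normalized M k k ≠ 0) (hi : i < k) :
    eliminated M k i =
      M i + (-(M i (rowLength (normalized M k k)))) • normalized M k k := by
  obtain ⟨d, h, -, -, h2⟩ := run_jordanOps (normalized M k) (normalized M k) k i
  rw [eliminated, h, h2 h0 hi, normalized_of_ne M hi.ne]

theorem eliminated_of_eq_zero {M : RFM} {k i : ℕ} (h0 : normalized M k k = 0) (hi : i < k) :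
    eliminated M k i = M i := by
  obtain ⟨d, h, h1, -, -⟩ := run_jordanOps (normalized M k) (normalized M k) k i
  rw [eliminated, h, h1 h0, normalized_of_ne M hi.ne]
  simp

/-- The new pivot row vanishes in the old pivot columns, so the old pivots stay `1`; it is added
only to rows at least as long as itself, so no length changes. -/
theorem eliminated_ne_zero_and_rowLength {M : RFM} {k : ℕ} (hM : Reduced k M) {i : ℕ}
    (hi : i < k) (hi0 : M i ≠ 0) :
    eliminated M k i (rowLength (M i)) = 1 ∧ eliminated M k i ≠ 0 ∧
      rowLength (eliminated M k i) = rowLength (M i) := by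
  by_cases h0 : normalized M k k = 0
  · rw [eliminated_of_eq_zero h0 hi]
    exact ⟨(hM i hi hi0).1, hi0, rfl⟩
  have h1 : eliminated M k i (rowLength (M i)) = 1 := by
    rw [eliminated_of_lt h0 hi]
    simp [(hM i hi hi0).1, normalized_clears hM hi hi0]
  refine ⟨h1, fun h => by simp [h] at h1, le_antisymm ?_ (le_rowLength (by simp [h1]))⟩
  rw [eliminated_of_lt h0 hi]
  exact rowLength_add_smul_le _ le_rfl fun hd => le_rowLength (neg_ne_zero.1 hd)

theorem eliminated_eq_zero {M : RFM} {k i : ℕ} (hi : i < k) (hi0 : M i = 0) :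
    eliminated M k i = 0 := by
  by_cases h0 : normalized M k k = 0
  · rw [eliminated_of_eq_zero h0 hi, hi0]
  · rw [eliminated_of_lt h0 hi, hi0]
    simp

theorem rowLength_eliminated {M : RFM} {k : ℕ} (hM : Reduced k M) {i : ℕ} (hi : i < k) :
    rowLength (eliminated M k i) = rowLength (M i) := by
  by_cases hi0 : M i = 0
  · rw [eliminated_eq_zero hi hi0, hi0]
  · exact (eliminated_ne_zero_and_rowLength hM hi hi0).2.2

theorem ne_zero_of_eliminated {M : RFM} {k i : ℕ} (hi : i < k)
    (h : eliminated M k i ≠ 0) : M i ≠ 0 := fun hi0 => h (eliminated_eq_zero hi hi0)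

theorem reduced_eliminated {M : RFM} {k : ℕ} (hM : Reduced k M) :
    Reduced (k + 1) (eliminated M k) := by
  intro i hi h
  rcases Nat.lt_succ_iff_lt_or_eq.1 hi with hi | rfl
  · have hi0 := ne_zero_of_eliminated hi h
    obtain ⟨h1, -, h3⟩ := eliminated_ne_zero_and_rowLength hM hi hi0
    rw [h3]
    refine ⟨h1, fun j hj hji => ?_⟩
    rcases Nat.lt_succ_iff_lt_or_eq.1 hj with hj | rfl
    · have hMj := (hM i hi hi0).2 j hj hji
      by_cases h0 : normalized M k k = 0
      · rw [eliminated_of_eq_zero h0 hj, hMj]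
      · rw [eliminated_of_lt h0 hj]
        simp [hMj, normalized_clears hM hi hi0]
    · rw [eliminated_self]
      exact normalized_clears hM hi hi0
  · rw [eliminated_self] at h ⊢
    refine ⟨normalized_pivot h, fun j hj hji => ?_⟩
    rw [eliminated_of_lt h (by omega)]
    simp [normalized_pivot h]

theorem sorted_eliminated {M : RFM} {k : ℕ} (hM : Reduced k M) (hS : Sorted k M) :
    Sorted k (eliminated M k) := by
  intro i j hij hj hi0 hj0
  rw [rowLength_eliminated hM hj, rowLength_eliminated hM (hij.trans hj)]
  exact hS i j hij hj (ne_zero_of_eliminated (hij.trans hj) hi0) (ne_zero_of_eliminated hj hj0)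

/-- The row permutations of stage `k`, carried out on any matrix. -/
theorem exists_perm_run_permOps (M : RFM) (k : ℕ) :
    ∃ σ : Equiv.Perm ℕ, (∀ N, run (permOps M k) N = fun r => N (σ r)) ∧
      ∀ r, r < k + 1 ↔ σ r < k + 1 := by
  classical
  by_cases h0 : M k = 0
  · exact ⟨1, fun N => by simp [permOps, h0], fun r => Iff.rfl⟩
  · obtain ⟨σ, h1, h2⟩ := exists_perm_run_map_swap k
      ((List.range k).filter fun j => M j ≠ 0 ∧ rowLength (M k) < rowLength (M j))
    have h3 : ∀ r, k < r → σ r = r := fun r hr => h2 r (by omega) (by simp; omega)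
    refine ⟨σ, fun N => by rw [← h1]; simp [permOps, h0], fun r => ⟨fun hr => ?_, fun hr => ?_⟩⟩
    · by_contra hc
      have := σ.injective (h3 (σ r) (by omega))
      omega
    · by_contra hc
      rw [h3 r (by omega)] at hr
      exact hc hr

theorem Reduced.run_permOps {M N : RFM} {k : ℕ} (hM : Reduced (k + 1) N) :
    Reduced (k + 1) (run (permOps M k) N) := by
  obtain ⟨σ, h1, h2⟩ := exists_perm_run_permOps M k
  rw [h1]
  intro i hi h
  obtain ⟨h3, h4⟩ := hM (σ i) ((h2 i).1 hi) h
  exact ⟨h3, fun j hj hji => h4 (σ j) ((h2 j).1 hj) fun h => hji (σ.injective h)⟩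

theorem Reduced.rowLength_ne {M : RFM} {k i j : ℕ} (hM : Reduced k M) (hi : i < k) (hj : j < k)
    (hij : i ≠ j) (hi0 : M i ≠ 0) (hj0 : M j ≠ 0) : rowLength (M i) ≠ rowLength (M j) := by
  intro h
  have h1 := (hM i hi hi0).1
  rw [h, (hM j hj hj0).2 i hi hij] at h1
  exact zero_ne_one h1

/-- The row permutations sort the rows, and do not make a row `n < k` longer. -/
theorem Sorted.run_permOps {M : RFM} {k : ℕ} (hM : Reduced (k + 1) M) (hS : Sorted k M) :
    Sorted (k + 1) (run (permOps M k) M) ∧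
      ∀ n < k, rowLength (run (permOps M k) M n) ≤ rowLength (M n) := by
  classical
  by_cases h0 : M k = 0
  · have : permOps M k = [] := by simp [permOps, h0]
    rw [this, run_nil]
    refine ⟨fun i j hij hj hi0 hj0 => ?_, fun n _ => le_rfl⟩
    rcases Nat.lt_succ_iff_lt_or_eq.1 hj with hj | rfl
    · exact hS i j hij hj hi0 hj0
    · exact absurd h0 hj0
  set L := (List.range k).filter fun j => M j ≠ 0 ∧ rowLength (M k) < rowLength (M j) with hL
  have hp : permOps M k = L.map fun j => .swap k j := by simp [permOps, h0, hL]
  have hmem : ∀ j, j ∈ L ↔ j < k ∧ M j ≠ 0 ∧ rowLength (M k) < rowLength (M j) := by simp [hL]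
  have hLs : L.Pairwise (· < ·) := List.pairwise_lt_range.filter _
  obtain ⟨h1, h2, h3⟩ := run_map_swap_sorted k L hLs (fun j hj => ((hmem j).1 hj).1) M
    (hLs.imp_of_mem fun {a b} ha hb h =>
      hS a b h ((hmem b).1 hb).1 ((hmem a).1 ha).2.1 ((hmem b).1 hb).2.1)
    (fun j hj => ((hmem j).1 hj).2.2)
  rw [hp]
  have hout : ∀ i, i ≠ k → i ∉ L → run (L.map fun j => .swap k j) M i = M i := by
    intro i hik hiL
    refine run_of_not_touches (fun op hop ht => ?_) M
    obtain ⟨j, hj, rfl⟩ := List.mem_map.1 hop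
    rcases ht with rfl | rfl
    · exact hik rfl
    · exact hiL hj
  have hlt : ∀ i < k, i ∉ L → M i ≠ 0 → rowLength (M i) < rowLength (M k) := by
    intro i hi hiL hi0
    have := hM.rowLength_ne (by omega) (by omega) hi.ne hi0 h0
    by_contra hc
    exact hiL ((hmem i).2 ⟨hi, hi0, by omega⟩)
  refine ⟨fun i j hij hj hi0 hj0 => ?_, fun n hn => ?_⟩
  · have hik : i < k := by omega
    by_cases hiL : i ∈ L <;> by_cases hjL : j = k ∨ j ∈ L
    · exact h2 i j hiL hjL hij
    · rw [not_or] at hjL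
      rw [hout j hjL.1 hjL.2] at hj0
      -- This case is contradictory: row `j` is longer than row `i`, hence than row `k`, and would
      -- belong to `L`.
      have h4 := hlt j (by omega) hjL.2 hj0
      have h5 := hS i j hij (by omega) ((hmem i).1 hiL).2.1 hj0
      have h6 := ((hmem i).1 hiL).2.2
      omega
    · rw [hout i hik.ne hiL] at hi0 ⊢
      exact (hlt i hik hiL hi0).trans_le (h1 j hjL)
    · rw [not_or] at hjL
      rw [hout i hik.ne hiL] at hi0 ⊢
      rw [hout j hjL.1 hjL.2] at hj0 ⊢
      exact hS i j hij (by omega) hi0 hj0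
  · by_cases hnL : n ∈ L
    · exact (h3 n hnL).le
    · rw [hout n hn.ne hnL]

/-! ### A whole stage -/

theorem run_stageOps_self (M : RFM) (k : ℕ) :
    run (stageOps M k) M = run (permOps (eliminated M k) k) (eliminated M k) := by
  rw [stageOps_eq, run_append, run_append, run_append]
  rfl

theorem reduced_sorted_run_stageOps {M : RFM} {k : ℕ} (hM : Reduced k M) (hS : Sorted k M) :
    Reduced (k + 1) (run (stageOps M k) M) ∧ Sorted (k + 1) (run (stageOps M k) M) := by
  rw [run_stageOps_self]
  exact ⟨(reduced_eliminated hM).run_permOps,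
    ((sorted_eliminated hM hS).run_permOps (reduced_eliminated hM)).1⟩

theorem rowLength_run_stageOps_le {M : RFM} {k : ℕ} (hM : Reduced k M) (hS : Sorted k M) {n : ℕ}
    (hn : n < k) : rowLength (run (stageOps M k) M n) ≤ rowLength (M n) := by
  rw [run_stageOps_self, ← rowLength_eliminated hM hn]
  exact ((sorted_eliminated hM hS).run_permOps (reduced_eliminated hM)).2 n hn

/-- A row shorter than the new pivot row is not touched in the stage. -/
theorem not_touches_of_mem_stageOps {M : RFM} {k : ℕ} (hM : Reduced k M) {n : ℕ} (hn : n < k)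
    (h : normalized M k k ≠ 0 → rowLength (M n) < rowLength (normalized M k k)) {op : RowOp}
    (hop : op ∈ stageOps M k) : ¬ op.Touches n := by
  intro ht
  simp only [stageOps_eq, List.mem_append] at hop
  rcases hop with ((hop | hop) | hop) | hop
  · exact hn.ne ((gaussOps_target hop).2.2 n ht)
  · exact hn.ne ((normOps_target hop).2.2 n ht)
  · obtain ⟨-, h0, h1⟩ := (jordanOps_target hop).2.2 n ht
    rw [normalized_of_ne M hn.ne] at h1
    exact absurd (le_rowLength h1) (not_le.2 (h h0))
  · rcases (permOps_target hop).2.2 n ht with h1 | ⟨-, h0, h1⟩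
    · exact hn.ne h1
    · rw [eliminated_self] at h0 h1
      rw [rowLength_eliminated hM hn] at h1
      exact absurd h1 (not_lt.2 (h h0).le)

/-! ### Invariants that grow from stage to stage -/

/-- The lengths of the nonzero rows among the first `k` ones. -/
def pivots (k : ℕ) (M : RFM) : Set ℕ := {c | ∃ i < k, M i ≠ 0 ∧ rowLength (M i) = c}

theorem mem_pivots_run_stageOps {M : RFM} {k i : ℕ} (hi : i < k + 1)
    (h0 : eliminated M k i ≠ 0) :
    rowLength (eliminated M k i) ∈ pivots (k + 1) (run (stageOps M k) M) := by
  obtain ⟨σ, h1, h2⟩ := exists_perm_run_permOps (eliminated M k) k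
  rw [run_stageOps_self, h1]
  refine ⟨σ.symm i, (h2 _).2 (by rwa [σ.apply_symm_apply]), ?_, ?_⟩
  · simpa
  · simp

theorem pivots_subset_run_stageOps {M : RFM} {k : ℕ} (hM : Reduced k M) :
    pivots k M ⊆ pivots (k + 1) (run (stageOps M k) M) := by
  rintro _ ⟨i, hi, hi0, rfl⟩
  obtain ⟨-, h2, h3⟩ := eliminated_ne_zero_and_rowLength hM hi hi0
  rw [← h3]
  exact mem_pivots_run_stageOps (by omega) h2

theorem rowLength_normalized_notMem_pivots {M : RFM} {k : ℕ} (hM : Reduced k M)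
    (h0 : normalized M k k ≠ 0) : rowLength (normalized M k k) ∉ pivots k M := by
  rintro ⟨i, hi, hi0, h⟩
  have h1 := normalized_pivot h0
  rw [← h, normalized_clears hM hi hi0] at h1
  exact zero_ne_one h1

/-- The span of those among the first `k` rows of `Q` whose images under `A` have length at
most `p`. -/
def boundedSpan (A Q : RFM) (p k : ℕ) : Submodule ℂ (ℕ →₀ ℂ) :=
  Submodule.span ℂ {x | ∃ i < k, rowLength (mul Q A i) ≤ p ∧ Q i = x}

/-- Jordan elimination turns `Q i` into `Q i + d • Q₂ k`. If `d ≠ 0`, row `i` of `mul Q A` has an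
entry in the new pivot column, so the pivot row also has length at most `p`. Both new rows are then
among the generators, and `Q i` is recovered from them. The permutation only relabels. -/
theorem boundedSpan_le_run_stageOps (A Q : RFM) (p k : ℕ) :
    boundedSpan A Q p k ≤ boundedSpan A (run (stageOps (mul Q A) k) Q) p (k + 1) := by
  set M := mul Q A with hM
  refine Submodule.span_le.2 ?_
  rintro _ ⟨i, hi, hp, rfl⟩
  obtain ⟨σ, h1, h2⟩ := exists_perm_run_permOps (eliminated M k) k
  set Q₂ := run (gaussOps M k ++ normOps (run (gaussOps M k) M) k) Q with hQ₂
  set Q₃ := run (jordanOps (normalized M k) k) Q₂ with hQ₃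
  have hM₂ : normalized M k = mul Q₂ A := by
    rw [normalized, ← run_append, hM, run_mul]
  have hM₃ : eliminated M k = mul Q₃ A := by
    rw [eliminated, hQ₃, ← run_mul, ← hM₂]
  have hrun : run (stageOps M k) Q = fun r => Q₃ (σ r) := by
    rw [stageOps_eq, run_append, run_append, h1]
  have hmem : ∀ j < k + 1, rowLength (eliminated M k j) ≤ p →
      Q₃ j ∈ boundedSpan A (run (stageOps M k) Q) p (k + 1) := by
    intro j hj hjp
    rw [hM₃] at hjp
    refine Submodule.subset_span ⟨σ.symm j, (h2 _).2 (by rwa [σ.apply_symm_apply]), ?_, ?_⟩ <;> rw [hrun]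
    · simpa [mul] using hjp
    · simp
  obtain ⟨d, hd, hd0, -, hd1⟩ := run_jordanOps (normalized M k) Q₂ k i
  obtain ⟨d', hd', -, hdk, -⟩ := run_jordanOps (normalized M k) Q₂ k k
  have hQk : Q₃ k = Q₂ k := by
    rw [hQ₃, hd', hdk rfl]
    simp
  have hQi : Q₂ i = Q i := run_gaussOps_normOps_of_ne _ _ _ hi.ne
  have hpk : d ≠ 0 → rowLength (normalized M k k) ≤ p := by
    intro hne
    have h0 : normalized M k k ≠ 0 := fun h => hne (hd0 h)
    rw [hd1 h0 hi, normalized_of_ne M hi.ne] at hne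
    exact (le_rowLength (neg_ne_zero.1 hne)).trans hp
  have hMi : eliminated M k i = M i + d • normalized M k k := by
    rw [hM₃, hM₂, mul_row, mul_row, hQ₃, hd, map_add, map_smul, hQi, hM, mul_row]
  have hi3 := hmem i (by omega) (hMi ▸ rowLength_add_smul_le d hp hpk)
  have hQ : Q i = Q₃ i - d • Q₃ k := by
    rw [hQk, hQ₃, hd, hQi, add_sub_cancel_right]
  rw [SetLike.mem_coe, hQ]
  refine Submodule.sub_mem _ hi3 ?_
  by_cases hne : d = 0
  · simp [hne]
  · exact Submodule.smul_mem _ d (hmem k (by omega) (by rw [eliminated_self]; exact hpk hne))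

/-! ### The algorithm -/

/-- The matrix before stage `k`. -/
def stageMatrix (A : RFM) (k : ℕ) : RFM := run (opsBefore A k) A

/-- The pivot row found in stage `k`. -/
def pivotRow (A : RFM) (k : ℕ) : ℕ →₀ ℂ := normalized (stageMatrix A k) k k

theorem opsBefore_succ (A : RFM) (k : ℕ) :
    opsBefore A (k + 1) = opsBefore A k ++ stageOps (stageMatrix A k) k := rfl

theorem stageMatrix_succ (A : RFM) (k : ℕ) :
    stageMatrix A (k + 1) = run (stageOps (stageMatrix A k) k) (stageMatrix A k) := by
  rw [stageMatrix, opsBefore_succ, run_append]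
  rfl

theorem stageMatrix_eq_mul (A : RFM) (k : ℕ) :
    stageMatrix A k = mul (run (opsBefore A k) one) A := by
  rw [← run_mul, one_mul, stageMatrix]

theorem opsBefore_elementary_below (A : RFM) (k : ℕ) :
    ∀ op ∈ opsBefore A k, op.IsElementary ∧ op.Below k := by
  induction k with
  | zero => simp [opsBefore]
  | succ k ih =>
    intro op hop
    rcases List.mem_append.1 hop with h | h
    · exact ⟨(ih op h).1, (ih op h).2.mono (by omega)⟩
    · exact stageOps_elementary_below h

theorem stageMatrix_reduced_sorted (A : RFM) (k : ℕ) :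
    Reduced k (stageMatrix A k) ∧ Sorted k (stageMatrix A k) := by
  induction k with
  | zero => exact ⟨fun i hi => absurd hi (by omega), fun i j _ hj => absurd hj (by omega)⟩
  | succ k ih =>
    rw [stageMatrix_succ]
    exact reduced_sorted_run_stageOps ih.1 ih.2

theorem pivots_stageMatrix_mono (A : RFM) : Monotone fun k => pivots k (stageMatrix A k) := by
  refine monotone_nat_of_le_succ fun k => ?_
  rw [stageMatrix_succ]
  exact pivots_subset_run_stageOps (stageMatrix_reduced_sorted A k).1

theorem pivotRow_length_injOn (A : RFM) :
    Set.InjOn (fun k => rowLength (pivotRow A k)) {k | pivotRow A k ≠ 0} := by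
  have key : ∀ k l, k < l → pivotRow A k ≠ 0 → pivotRow A l ≠ 0 →
      rowLength (pivotRow A k) ≠ rowLength (pivotRow A l) := by
    intro k l hkl hk hl he
    refine rowLength_normalized_notMem_pivots (stageMatrix_reduced_sorted A l).1 hl ?_
    refine pivots_stageMatrix_mono A (show k + 1 ≤ l from hkl) ?_
    rw [← pivotRow, ← he]
    simp only [stageMatrix_succ]
    have := mem_pivots_run_stageOps (M := stageMatrix A k) (lt_add_one k)
      (by rwa [eliminated_self])
    rwa [eliminated_self] at this
  intro k hk l hl h
  rcases lt_trichotomy k l with h1 | h1 | h1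
  · exact absurd h (key k l h1 hk hl)
  · exact h1
  · exact absurd h.symm (key l k h1 hl hk)

/-- From some stage on, all new pivots lie to the right of column `p`. -/
theorem exists_forall_lt_pivotRow_length (A : RFM) (p : ℕ) :
    ∃ K, ∀ k ≥ K, pivotRow A k ≠ 0 → p < rowLength (pivotRow A k) := by
  have hfin : {k | pivotRow A k ≠ 0 ∧ rowLength (pivotRow A k) ≤ p}.Finite :=
    Set.Finite.of_injOn (t := Set.Iic p) (f := fun k => rowLength (pivotRow A k))
      (fun k hk => hk.2) ((pivotRow_length_injOn A).mono fun k hk => hk.1) (Set.finite_Iic p)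
  obtain ⟨K, hK⟩ := hfin.bddAbove
  refine ⟨K + 1, fun k hk h0 => ?_⟩
  by_contra hc
  have : k ≤ K := hK ⟨h0, not_lt.1 hc⟩
  omega

theorem rowLength_stageMatrix_le (A : RFM) {n k l : ℕ} (hn : n < k) (hkl : k ≤ l) :
    rowLength (stageMatrix A l n) ≤ rowLength (stageMatrix A k n) := by
  induction l, hkl using Nat.le_induction with
  | base => exact le_rfl
  | succ l hl ih =>
    obtain ⟨hR, hS⟩ := stageMatrix_reduced_sorted A l
    rw [stageMatrix_succ]
    exact (rowLength_run_stageOps_le hR hS (by omega)).trans ih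

/-- Row `n` is not touched any more from stage `N` on. -/
def FinalFrom (A : RFM) (n N : ℕ) : Prop :=
  ∀ k ≥ N, ∀ op ∈ stageOps (stageMatrix A k) k, ¬ op.Touches n

theorem finalFrom_of_rowLength_le (A : RFM) {p n N : ℕ} (hn : n < N)
    (hp : rowLength (stageMatrix A N n) ≤ p)
    (hN : ∀ k ≥ N, pivotRow A k ≠ 0 → p < rowLength (pivotRow A k)) : FinalFrom A n N := by
  intro k hk op hop
  refine not_touches_of_mem_stageOps (stageMatrix_reduced_sorted A k).1 (by omega)
    (fun h0 => ?_) hop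
  exact ((rowLength_stageMatrix_le A hn hk).trans hp).trans_lt (hN k hk h0)

theorem exists_finalFrom (A : RFM) (n : ℕ) : ∃ N, FinalFrom A n N := by
  -- Row `n` is inserted in stage `n`; its length right after that stage bounds all later ones.
  obtain ⟨K, hK⟩ := exists_forall_lt_pivotRow_length A (rowLength (stageMatrix A (n + 1) n))
  exact ⟨max K (n + 1), finalFrom_of_rowLength_le A (by omega)
    (rowLength_stageMatrix_le A (by omega) (by omega)) fun k hk => hK k (by omega)⟩

theorem FinalFrom.mono {A : RFM} {n N N' : ℕ} (h : FinalFrom A n N) (hN : N ≤ N') :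
    FinalFrom A n N' := fun k hk => h k (hN.trans hk)

theorem exists_opsBefore_append (A : RFM) {N k : ℕ} (h : N ≤ k) :
    ∃ t, opsBefore A k = opsBefore A N ++ t ∧
      ∀ op ∈ t, ∃ m ≥ N, op ∈ stageOps (stageMatrix A m) m := by
  induction k, h using Nat.le_induction with
  | base => exact ⟨[], by simp⟩
  | succ k hk ih =>
    obtain ⟨t, h1, h2⟩ := ih
    refine ⟨t ++ stageOps (stageMatrix A k) k, ?_, fun op hop => ?_⟩
    · rw [opsBefore_succ, h1, List.append_assoc]
    · rcases List.mem_append.1 hop with h | h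
      · exact h2 op h
      · exact ⟨k, hk, h⟩

theorem FinalFrom.run_eq {A : RFM} {n N : ℕ} (h : FinalFrom A n N) (M : RFM) {l : List RowOp}
    (hl : IsInitialSegment A l) (hN : opsBefore A N <+: l) :
    run l M n = run (opsBefore A N) M n := by
  obtain ⟨k, hk⟩ := hl
  obtain ⟨t, rfl⟩ := hN
  rw [run_append]
  refine run_of_not_touches (fun op hop => ?_) _
  rcases le_total N k with hNk | hNk
  · obtain ⟨s, hs, hs'⟩ := exists_opsBefore_append A hNk
    rw [hs, List.prefix_append_right_inj] at hk
    obtain ⟨m, hm, hmop⟩ := hs' op (hk.subset hop)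
    exact h m hm op hmop
  -- Here `l` is squeezed between prefixes, so nothing follows `opsBefore A N`.
  · obtain ⟨s, hs, -⟩ := exists_opsBefore_append A hNk
    have h1 := hk.length_le
    rw [hs] at h1
    simp only [List.length_append] at h1
    have : t = [] := List.length_eq_zero_iff.1 (by omega)
    simp [this] at hop

theorem FinalFrom.run_opsBefore_eq {A : RFM} {n N k : ℕ} (h : FinalFrom A n N) (M : RFM)
    (hk : N ≤ k) : run (opsBefore A k) M n = run (opsBefore A N) M n :=
  h.run_eq M ⟨k, List.prefix_rfl⟩ (by
    obtain ⟨t, ht, -⟩ := exists_opsBefore_append A hk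
    exact ⟨t, ht.symm⟩)

/-- A stage from which on row `n` is final. -/
def finalStage (A : RFM) (n : ℕ) : ℕ := (exists_finalFrom A n).choose

theorem finalFrom_finalStage (A : RFM) (n : ℕ) : FinalFrom A n (finalStage A n) :=
  (exists_finalFrom A n).choose_spec

/-- The matrix of final rows when the whole sequence of operations is carried out on `M`. -/
def result (A M : RFM) : RFM := fun n => run (opsBefore A (finalStage A n)) M n

theorem resultsIn_result (A M : RFM) : ResultsIn A M (result A M) :=
  fun n => ⟨finalStage A n, fun _ hl hN => (finalFrom_finalStage A n).run_eq M hl hN⟩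

theorem FinalFrom.result_eq {A : RFM} {n N : ℕ} (h : FinalFrom A n N) (M : RFM) :
    result A M n = run (opsBefore A N) M n := by
  rw [← h.run_opsBefore_eq M (le_max_left N (finalStage A n)),
    (finalFrom_finalStage A n).run_opsBefore_eq M (le_max_right N (finalStage A n)), result]

theorem result_one_mul (A : RFM) : mul (result A one) A = result A A := by
  funext n
  -- `finalStage A n` depends on the operations only, so row `n` of both results is read at the same
  -- stage.
  show mul (run (opsBefore A (finalStage A n)) one) A n = _
  rw [← stageMatrix_eq_mul]
  rfl

/-- Finitely many rows of the result agree with those of some stage. -/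
theorem exists_stage_eq_result (A M : RFM) (s : Finset ℕ) :
    ∃ k, ∀ n ∈ s, n < k ∧ result A M n = run (opsBefore A k) M n := by
  refine ⟨s.sup fun n => max (n + 1) (finalStage A n), fun n hn => ?_⟩
  have h : max (n + 1) (finalStage A n) ≤ s.sup fun n => max (n + 1) (finalStage A n) :=
    Finset.le_sup (f := fun n => max (n + 1) (finalStage A n)) hn
  exact ⟨by omega, ((finalFrom_finalStage A n).mono (by omega)).result_eq M⟩

theorem isQHF_result (A : RFM) : IsQHF (result A A) := by
  have key : ∀ i j, ∃ k, i < k ∧ j < k ∧ result A A i = stageMatrix A k i ∧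
      result A A j = stageMatrix A k j := by
    intro i j
    obtain ⟨k, hk⟩ := exists_stage_eq_result A A {i, j}
    obtain ⟨h1, h2⟩ := hk i (by simp)
    obtain ⟨h3, h4⟩ := hk j (by simp)
    exact ⟨k, h1, h3, h2, h4⟩
  refine ⟨fun i j hij hi hj => ?_, fun j hj => ?_, fun j m hj hjm => ?_⟩
  · obtain ⟨k, -, h2, h3, h4⟩ := key i j
    rw [h3] at hi ⊢
    rw [h4] at hj ⊢
    exact (stageMatrix_reduced_sorted A k).2 i j hij h2 hi hj
  · obtain ⟨k, h1, -, h3, -⟩ := key j j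
    rw [h3] at hj ⊢
    exact ((stageMatrix_reduced_sorted A k).1 j h1 hj).1
  · obtain ⟨k, h1, h2, h3, h4⟩ := key j m
    rw [h3] at hj ⊢
    rw [h4]
    exact ((stageMatrix_reduced_sorted A k).1 j h1 hj).2 m h2 hjm.symm

/-! ### Nonsingularity of the composite -/

theorem injective_result_one (A : RFM) :
    Function.Injective (Finsupp.linearCombination ℂ (result A one)) := by
  rw [injective_iff_map_eq_zero]
  intro x hx
  obtain ⟨k, hk⟩ := exists_stage_eq_result A one x.support
  have h : Finsupp.linearCombination ℂ (run (opsBefore A k) one) x = 0 := by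
    rw [← hx, Finsupp.linearCombination_apply, Finsupp.linearCombination_apply]
    exact Finsupp.sum_congr fun n hn => by rw [(hk n hn).2]
  exact (injective_iff_map_eq_zero _).1
    (injective_run_one fun op hop => (opsBefore_elementary_below A k op hop).1) x h

theorem boundedSpan_mono (A : RFM) (p : ℕ) :
    Monotone fun k => boundedSpan A (run (opsBefore A k) one) p k := by
  refine monotone_nat_of_le_succ fun k => ?_
  have h := boundedSpan_le_run_stageOps A (run (opsBefore A k) one) p k
  rwa [← stageMatrix_eq_mul, ← run_append, ← opsBefore_succ] at h

theorem single_mem_span_result_one (A : RFM) (n : ℕ) :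
    one n ∈ Submodule.span ℂ (Set.range (result A one)) := by
  set Q := fun k => run (opsBefore A k) one with hQ
  -- With this `p`, the bounded span at stage `n + 1` contains all of the first `n + 1` rows, hence
  -- `one n`.
  set p := (Finset.range (n + 1)).sup fun i => rowLength (stageMatrix A (n + 1) i) with hp
  obtain ⟨K, hK⟩ := exists_forall_lt_pivotRow_length A p
  have h1 : one n ∈ boundedSpan A (Q (n + 1)) p (n + 1) := by
    refine Submodule.span_mono ?_ (mem_span_run
      (fun op hop => (opsBefore_elementary_below A (n + 1) op hop).1)
      (fun op hop => (opsBefore_elementary_below A (n + 1) op hop).2) one (lt_add_one n))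
    rintro _ ⟨i, hi, rfl⟩
    refine ⟨i, hi, ?_, rfl⟩
    rw [← stageMatrix_eq_mul]
    exact Finset.le_sup (f := fun i => rowLength (stageMatrix A (n + 1) i))
      (Finset.mem_range.2 hi)
  have h2 := boundedSpan_mono A p (le_max_left (n + 1) K) h1
  refine Submodule.span_le.2 ?_ h2
  rintro _ ⟨i, hi, hip, rfl⟩
  rw [← stageMatrix_eq_mul] at hip
  -- The generators at this stage have images of length at most `p`, and all later pivots lie beyond
  -- `p`.
  have hf : FinalFrom A i (max (n + 1) K) :=
    finalFrom_of_rowLength_le A hi hip fun k hk => hK k (by omega)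
  exact Submodule.subset_span ⟨i, hf.result_eq one⟩

theorem nonsingular_result_one (A : RFM) : Nonsingular (result A one) := by
  refine nonsingular_of_bijective ⟨injective_result_one A, ?_⟩
  rw [← LinearMap.range_eq_top, Finsupp.range_linearCombination, eq_top_iff]
  intro x _
  rw [← linearCombination_one x, Finsupp.linearCombination_apply]
  exact Submodule.sum_mem _ fun i _ =>
    Submodule.smul_mem _ _ (single_mem_span_result_one A i)

end RFM

end

/-- For every row-finite `A`, the infinite Gauss–Jordan algorithm with rightmost pivoting consists
of elementary row operations; carried out on `A` they result in a matrix `H` and carried out on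
the identity matrix they result in a matrix `Q` (their composite), where `Q` is nonsingular,
`Q · A = H`, so that `A` and `H` are left associates, and `H` is in quasi-Hermite form. -/
theorem theorem3 (A : RFM) :
    (∀ k, ∀ op ∈ RFM.opsBefore A k, op.IsElementary) ∧
    ∃ H Q : RFM,
      RFM.ResultsIn A A H ∧
      RFM.ResultsIn A RFM.one Q ∧
      RFM.Nonsingular Q ∧
      RFM.mul Q A = H ∧
      RFM.LeftAssociates A H ∧
      RFM.IsQHF H := by
  exact ⟨fun k op hop => (RFM.opsBefore_elementary_below A k op hop).1, RFM.result A A,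
    RFM.result A RFM.one, RFM.resultsIn_result A A, RFM.resultsIn_result A RFM.one,
    RFM.nonsingular_result_one A, RFM.result_one_mul A,
    ⟨RFM.result A RFM.one, RFM.nonsingular_result_one A, RFM.result_one_mul A⟩,
    RFM.isQHF_result A⟩
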